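/- Let $q\ge 0$ be real, and write $[i]=1+q+\dots+q^{i-1}$ and $[n]!=[1][2]\cdots[n]$. A configuration of size $n$ is a tuple $c=(c_1,\dots,c_n)$ of nonnegative integers with $c_1+\dots+c_n=n$. Drop $n$ balls one at a time onto the initially empty line $\mathbb Z$, with exactly $c_i$ balls dropped at site $i$, in some chosen order. A ball that is on top of another ball moves one site to the left with probability $q/(1+q)$ and one site to the right with probability $1/(1+q)$, repeatedly and independently, until it reaches an empty site, where it stays; then the next ball is dropped. Let $\mathbb P(c\to[1;n])_q$ be the probability that the final set of occupied sites is $\{1,\dots,n\}$. The remixed Eulerian number of $c$ is $A_c(q)=[n]!\,\mathbb P(c\to[1;n])_q$. For integers $x,y\ge 1$ and $r,s\ge 0$ put $$A(r,s|x,y)_q:=\frac{1}{[x+y-1]!}\,A_{(0^r,1^{y-1},r+s+1,1^{x-1},0^s)}(q),$$ where $a^k$ stands for $k$ consecutive entries equal to $a$. Proposition. Whatever order of dropping the balls is chosen for each configuration, for all real $q\ge 0$, all integers $x,y\ge1$ and all integers $r,s\ge 0$ with $(r,s)\ne(0,0)$, $$A(r,s|x,y)_q=q^{\,r+y-1}\,[s+x]\,A(r-1,s|x,y)_q+[r+y]\,A(r,s-1|x,y)_q,$$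 where the first term on the right is omitted if $r=0$ and the second is omitted if $s=0$. Moreover $A(0,0|x,y)_q=1$. -/

import Mathlib

open scoped NNReal ENNReal

noncomputable section

namespace RemixedEulerian

/-- The `q`-integer `[i] = 1 + q + ⋯ + q^(i-1)`. -/
def qInt (q : ℝ≥0) (i : ℕ) : ℝ := ∑ k ∈ Finset.range i, (q : ℝ) ^ k

/-- The `q`-factorial `[n]! = [1][2]⋯[n]`. -/
def qFactorial (q : ℝ≥0) (n : ℕ) : ℝ := ∏ i ∈ Finset.Icc 1 n, qInt q i

/-- A configuration: a tuple `(c_1, …, c_n)` of natural numbers with `c_1 + ⋯ + c_n = n`. -/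
structure Configuration where
  tuple : List ℕ
  sum_eq_length : tuple.sum = tuple.length

/-- The number `n` of balls (which is also the number of sites) of a configuration. -/
def Configuration.size (c : Configuration) : ℕ := c.tuple.length

/-- `MSet(c)`: the multiset of sites in which `i ∈ {1, …, n}` occurs `c_i` times. -/
def Configuration.mset (c : Configuration) : Multiset ℤ :=
  ∑ i : Fin c.tuple.length, Multiset.replicate (c.tuple.get i) ((i : ℤ) + 1)

/-- A state of the particle model: the set of occupied sites of `ℤ`, and the list of the balls
that have not come to rest yet, each recorded by its current position. The head of the list is the
ball that is moving; the others wait to be dropped, in this order. -/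
abbrev State : Type := Finset ℤ × List ℤ

/-- The random direction of a move: `true` (left) with probability `q / (1 + q)`,
`false` (right) with probability `1 / (1 + q)`. -/
def direction (q : ℝ≥0) : PMF Bool :=
  PMF.ofFintype (fun b => ((cond b (q / (1 + q)) (1 / (1 + q)) : ℝ≥0) : ℝ≥0∞)) (by
    rw [Fintype.sum_bool, ← ENNReal.coe_add, ← ENNReal.coe_one, ENNReal.coe_inj]
    simp only [cond_true, cond_false]
    rw [← add_div, add_comm q 1]
    exact div_self (by positivity))

/-- One step of the dynamics. If the moving ball is at an empty site, it stays there for good and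
the next ball is dropped; if it is on top of another ball, it moves one site left or right. When
all the balls are at rest, nothing happens any more. -/
def step (q : ℝ≥0) : State → PMF State
  | (S, []) => PMF.pure (S, [])
  | (S, p :: u) =>
      if p ∈ S then
        (direction q).map (fun left => (S, (if left then p - 1 else p + 1) :: u))
      else PMF.pure (insert p S, u)

/-- The law of the state after `N` steps. -/
def run (q : ℝ≥0) : ℕ → State → PMF State
  | 0, s => PMF.pure s
  | N + 1, s => (step q s).bind (run q N)

/-- The probability that `T` is the final support when the balls `u = (u_1, …, u_n)` are dropped
in this order on the empty line: the supremum (which is the limit, as the states without moving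
balls are absorbing) over `N` of the probability that after `N` steps all balls are at rest and
occupy exactly `T`. -/
def finalSupportProb (q : ℝ≥0) (u : List ℤ) (T : Finset ℤ) : ℝ :=
  (⨆ N : ℕ, run q N (∅, u) (T, [])).toReal

/-- The remixed Eulerian number `A_c(q) = [n]! ℙ(c → {1, …, n})_q`, where the balls of `c` are
dropped in the order `order c`. -/
def remixedEulerian (order : Configuration → List ℤ) (q : ℝ≥0) (c : Configuration) : ℝ :=
  qFactorial q c.size * finalSupportProb q (order c) (Finset.Icc 1 (c.size : ℤ))

/-- The configuration `(0^r, 1^(y-1), r+s+1, 1^(x-1), 0^s)`, for positive `x` and `y`. -/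
def csConfiguration (r s x y : ℕ) : Configuration where
  tuple := List.replicate r 0 ++ List.replicate (y - 1) 1 ++ [r + s + 1] ++
    List.replicate (x - 1) 1 ++ List.replicate s 0
  sum_eq_length := by
    simp
    omega

/-- `A(r,s|x,y)_q = A_{(0^r, 1^(y-1), r+s+1, 1^(x-1), 0^s)}(q) / [x+y-1]!`, for positive
`x` and `y`. -/
def genEulerian (order : Configuration → List ℤ) (q : ℝ≥0) (r s x y : ℕ) : ℝ :=
  remixedEulerian order q (csConfiguration r s x y) / qFactorial q (x + y - 1)

end RemixedEulerian

end

open scoped NNReal ENNReal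

noncomputable section

namespace RemixedEulerian

/-! ### `q`-integers -/

/-! The final support has the same law for every dropping order (`supportProb_perm`), because
harmonic functions on a finite set are determined by their outside values. So first drop one ball on
each of the `x + y - 1` sites of the nonzero block; these stay put. The `r + s` remaining balls all
fall at `M = r + y`, and each extends the interval by one site, with gambler's-ruin probabilities
that are ratios of `q`-integers (`supportProb_siteInterval`). The desired probability is thus a
weighted count of lattice paths from `(0, 0)` to `(r, s)`. Splitting by the last step gives the
recursion: its denominator `[x + y + r + s - 1]` is exactly the top factor of the `q`-factorial and
cancels. -/

lemma qInt_zero (q : ℝ≥0) : qInt q 0 = 0 := by simp [qInt]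

lemma qInt_add (q : ℝ≥0) (a b : ℕ) : qInt q (a + b) = qInt q a + (q : ℝ) ^ a * qInt q b := by
  simp only [qInt, Finset.sum_range_add, pow_add, Finset.mul_sum]

lemma qInt_succ_pos (q : ℝ≥0) (n : ℕ) : 0 < qInt q (n + 1) := by
  rw [qInt, Finset.sum_range_succ', pow_zero]
  positivity

/-- This makes `k ↦ [k]` harmonic for the walk, hence the source of the exit probabilities. -/
lemma qInt_balance (q : ℝ≥0) (k : ℕ) :
    (1 + (q : ℝ)) * qInt q (k + 1) = q * qInt q k + qInt q (k + 2) := by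
  have h1 : qInt q (k + 1) = qInt q k + (q : ℝ) ^ k := by simp [qInt, Finset.sum_range_succ]
  have h2 : qInt q (k + 2) = qInt q k + (q : ℝ) ^ k + (q : ℝ) ^ (k + 1) := by
    simp [qInt, Finset.sum_range_succ]
  have h3 : qInt q (k + 1) = 1 + q * qInt q k := by
    rw [add_comm k 1, qInt_add]; simp [qInt]
  linear_combination q * h1 - h2 + h1

lemma qFactorial_succ (q : ℝ≥0) (n : ℕ) :
    qFactorial q (n + 1) = qFactorial q n * qInt q (n + 1) :=
  Finset.prod_Icc_succ_top (by omega) _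

lemma qFactorial_pos (q : ℝ≥0) (n : ℕ) : 0 < qFactorial q n := by
  induction n with
  | zero => simp [qFactorial]
  | succ n ih => rw [qFactorial_succ]; exact mul_pos ih (qInt_succ_pos q n)

/-! ### Hitting probabilities -/

/-- The probability that the dynamics started at `s` ends with final support `T`. -/
def supportProb (q : ℝ≥0) (T : Finset ℤ) (s : State) : ℝ :=
  (⨆ N : ℕ, run q N s (T, [])).toReal

lemma run_nil (q : ℝ≥0) (N : ℕ) (S : Finset ℤ) : run q N (S, []) = PMF.pure (S, []) := by
  induction N with
  | zero => rfl
  | succ N ih => rw [run, step, PMF.pure_bind, ih]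

lemma run_succ_rest (q : ℝ≥0) (N : ℕ) {S : Finset ℤ} {p : ℤ} (hp : p ∉ S) (u : List ℤ) :
    run q (N + 1) (S, p :: u) = run q N (insert p S, u) := by
  rw [run, step, if_neg hp, PMF.pure_bind]

lemma run_succ_move (q : ℝ≥0) (N : ℕ) {S : Finset ℤ} {p : ℤ} (hp : p ∈ S) (u : List ℤ)
    (t : State) :
    run q (N + 1) (S, p :: u) t =
      ((q / (1 + q) : ℝ≥0) : ℝ≥0∞) * run q N (S, (p - 1) :: u) t +
        ((1 / (1 + q) : ℝ≥0) : ℝ≥0∞) * run q N (S, (p + 1) :: u) t := by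
  rw [run, step, if_pos hp, PMF.bind_map, PMF.bind_apply, tsum_fintype, Fintype.sum_bool]
  simp [direction]

/-- The state `(T, [])` is absorbing. Monotonicity lets the supremum be shifted by one step and
commute with sums. -/
lemma run_mono (q : ℝ≥0) (T : Finset ℤ) (s : State) : Monotone fun N => run q N s (T, []) := by
  refine monotone_nat_of_le_succ fun N => ?_
  induction N generalizing s with
  | zero =>
    by_cases h : s = (T, [])
    · subst h; rw [run_nil, run_nil]
    · simp [run, Ne.symm h]
  | succ N ih =>
    rw [run, run, PMF.bind_apply, PMF.bind_apply]
    exact ENNReal.tsum_le_tsum fun a => mul_le_mul_right (ih a) _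

lemma iSup_run_ne_top (q : ℝ≥0) (T : Finset ℤ) (s : State) :
    (⨆ N : ℕ, run q N s (T, [])) ≠ ∞ :=
  ne_top_of_le_ne_top ENNReal.one_ne_top (iSup_le fun _ => PMF.coe_le_one _ _)

lemma supportProb_nil (q : ℝ≥0) (T S : Finset ℤ) :
    supportProb q T (S, []) = if S = T then 1 else 0 := by
  simp only [supportProb, run_nil, ciSup_const, PMF.pure_apply, Prod.mk.injEq, and_true]
  by_cases h : S = T
  · simp [h]
  · simp [h, Ne.symm h]

lemma supportProb_rest (q : ℝ≥0) (T : Finset ℤ) {S : Finset ℤ} {p : ℤ} (hp : p ∉ S)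
    (u : List ℤ) : supportProb q T (S, p :: u) = supportProb q T (insert p S, u) := by
  rw [supportProb, ← (run_mono q T (S, p :: u)).iSup_nat_add 1]
  simp only [run_succ_rest q _ hp, supportProb]

lemma supportProb_move (q : ℝ≥0) (T : Finset ℤ) {S : Finset ℤ} {p : ℤ} (hp : p ∈ S)
    (u : List ℤ) :
    (1 + (q : ℝ)) * supportProb q T (S, p :: u) =
      q * supportProb q T (S, (p - 1) :: u) + supportProb q T (S, (p + 1) :: u) := by
  have key : supportProb q T (S, p :: u) =
      (q / (1 + q) : ℝ) * supportProb q T (S, (p - 1) :: u) +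
        (1 / (1 + q) : ℝ) * supportProb q T (S, (p + 1) :: u) := by
    rw [supportProb, ← (run_mono q T (S, p :: u)).iSup_nat_add 1]
    simp only [run_succ_move q _ hp]
    rw [← ENNReal.iSup_add_iSup_of_monotone, ← ENNReal.mul_iSup, ← ENNReal.mul_iSup,
      ENNReal.toReal_add, ENNReal.toReal_mul, ENNReal.toReal_mul]
    · simp only [ENNReal.coe_toReal, NNReal.coe_div, NNReal.coe_add, NNReal.coe_one, supportProb]
    · exact ENNReal.mul_ne_top ENNReal.coe_ne_top (iSup_run_ne_top q T _)
    · exact ENNReal.mul_ne_top ENNReal.coe_ne_top (iSup_run_ne_top q T _)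
    · exact fun a b h => mul_le_mul_right (run_mono q T _ h) _
    · exact fun a b h => mul_le_mul_right (run_mono q T _ h) _
  have : (1 + (q : ℝ)) ≠ 0 := by positivity
  rw [key]
  field_simp

/-! ### Harmonic functions -/

/-- `g` is harmonic on `S` for the random walk with directions of law `direction q`. -/
def HarmonicOn (q : ℝ≥0) (g : ℤ → ℝ) (S : Finset ℤ) : Prop :=
  ∀ p ∈ S, (1 + (q : ℝ)) * g p = q * g (p - 1) + g (p + 1)

/-- Maximum principle, with zero boundary values at the outer neighbours of `S`. -/
lemma HarmonicOn.nonpos {q : ℝ≥0} {g : ℤ → ℝ} {S : Finset ℤ} (hg : HarmonicOn q g S)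
    (h0 : ∀ p ∉ S, (p - 1 ∈ S ∨ p + 1 ∈ S) → g p = 0) : ∀ p ∈ S, g p ≤ 0 := by
  by_contra! hpos
  obtain ⟨p₀, hp₀, hgp₀⟩ := hpos
  obtain ⟨m, hm, hmax⟩ := S.exists_max_image g ⟨p₀, hp₀⟩
  have hM : 0 < g m := hgp₀.trans_le (hmax p₀ hp₀)
  have hne : (S.filter fun p => g p = g m).Nonempty := ⟨m, by simp [hm]⟩
  -- The rightmost maximizer is taken because only the step to the right keeps positive weight when
  -- `q = 0`.
  obtain ⟨p, hp, hlast⟩ := Finset.exists_max_image _ (fun p : ℤ => p) hne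
  simp only [Finset.mem_filter] at hp hlast
  have hl : g (p - 1) ≤ g m := by
    by_cases h : p - 1 ∈ S
    · exact hmax _ h
    · rw [h0 _ h (Or.inr (by simpa using hp.1))]; exact hM.le
  have hr : g (p + 1) < g m := by
    by_cases h : p + 1 ∈ S
    · refine lt_of_le_of_ne (hmax _ h) fun he => ?_
      have := hlast _ ⟨h, he⟩
      omega
    · rw [h0 _ h (Or.inl (by simpa using hp.1))]; exact hM
  have := hg p hp.1
  rw [hp.2] at this
  nlinarith [mul_le_mul_of_nonneg_left hl q.coe_nonneg]

lemma HarmonicOn.eqOn {q : ℝ≥0} {f g : ℤ → ℝ} {S : Finset ℤ} (hf : HarmonicOn q f S)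
    (hg : HarmonicOn q g S) (h0 : ∀ p ∉ S, (p - 1 ∈ S ∨ p + 1 ∈ S) → f p = g p) :
    ∀ p ∈ S, f p = g p := by
  intro p hp
  have h1 : HarmonicOn q (fun p => f p - g p) S := fun p hp => by
    linear_combination hf p hp - hg p hp
  have h2 : HarmonicOn q (fun p => g p - f p) S := fun p hp => by
    linear_combination hg p hp - hf p hp
  have h3 := h1.nonpos (fun p hp hn => by rw [h0 p hp hn, sub_self]) p hp
  have h4 := h2.nonpos (fun p hp hn => by rw [h0 p hp hn, sub_self]) p hp
  linarith

lemma HarmonicOn.ext {q : ℝ≥0} {f g : ℤ → ℝ} {S : Finset ℤ} (hf : HarmonicOn q f S)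
    (hg : HarmonicOn q g S) (h0 : ∀ p ∉ S, f p = g p) (p : ℤ) : f p = g p := by
  by_cases hp : p ∈ S
  · exact hf.eqOn hg (fun p hp _ => h0 p hp) p hp
  · exact h0 p hp

lemma harmonicOn_supportProb (q : ℝ≥0) (T S : Finset ℤ) (u : List ℤ) :
    HarmonicOn q (fun p => supportProb q T (S, p :: u)) S :=
  fun _ hp => supportProb_move q T hp u

/-! ### The abelian property -/

/-- For fixed `r`, both sides of the balance equation are harmonic in `p`. They agree for `p ∉ S`,
where the first ball rests at once and the second moves from `r ∈ insert p S`. -/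
lemma harmonicOn_supportProb_second (q : ℝ≥0) (T S : Finset ℤ) (p : ℤ) (u : List ℤ) :
    HarmonicOn q (fun r => supportProb q T (S, p :: r :: u)) S := by
  intro r hr
  refine HarmonicOn.ext
    (f := fun p => (1 + (q : ℝ)) * supportProb q T (S, p :: r :: u))
    (g := fun p => q * supportProb q T (S, p :: (r - 1) :: u) +
      supportProb q T (S, p :: (r + 1) :: u)) (q := q) (S := S) ?_ ?_ ?_ p
  · intro p hp
    linear_combination (1 + (q : ℝ)) * supportProb_move q T hp (r :: u)
  · intro p hp
    linear_combination (q : ℝ) * supportProb_move q T hp ((r - 1) :: u) +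
      supportProb_move q T hp ((r + 1) :: u)
  · intro p hp
    simp only [supportProb_rest q T hp]
    exact supportProb_move q T (Finset.mem_insert_of_mem hr) u

/-- Both sides are harmonic in each position, so uniqueness, used once per variable, reduces to `p,
r ∉ S`. There either `p = r` or both balls rest where they fall. -/
lemma supportProb_swap (q : ℝ≥0) (T S : Finset ℤ) (p r : ℤ) (u : List ℤ) :
    supportProb q T (S, p :: r :: u) = supportProb q T (S, r :: p :: u) := by
  refine (harmonicOn_supportProb q T S (r :: u)).ext
    (harmonicOn_supportProb_second q T S r u) (fun p hp => ?_) p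
  refine (harmonicOn_supportProb_second q T S p u).ext
    (harmonicOn_supportProb q T S (p :: u)) (fun r hr => ?_) r
  by_cases h : p = r
  · rw [h]
  · rw [supportProb_rest q T hp, supportProb_rest q T (by simp [hr, Ne.symm h]),
      supportProb_rest q T hr, supportProb_rest q T (by simp [hp, h]), Finset.insert_comm]

lemma supportProb_perm (q : ℝ≥0) (T : Finset ℤ) {u v : List ℤ} (h : u.Perm v) (S : Finset ℤ) :
    supportProb q T (S, u) = supportProb q T (S, v) := by
  induction h generalizing S with
  | nil => rfl
  | @cons p u v _ ih =>
    exact (harmonicOn_supportProb q T S u).ext (harmonicOn_supportProb q T S v)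
      (fun p hp => by rw [supportProb_rest q T hp, supportProb_rest q T hp, ih]) p
  | swap p r u => exact supportProb_swap q T S r p u
  | trans _ _ ih₁ ih₂ => rw [ih₁, ih₂]

lemma supportProb_append_of_nodup (q : ℝ≥0) (T : Finset ℤ) (v w : List ℤ) (hv : v.Nodup)
    (S : Finset ℤ) (hS : ∀ p ∈ v, p ∉ S) :
    supportProb q T (S, v ++ w) = supportProb q T (v.toFinset ∪ S, w) := by
  induction v generalizing S with
  | nil => simp
  | cons p v ih =>
    rw [List.nodup_cons] at hv
    rw [List.cons_append, supportProb_rest q T (hS p (by simp)), ih hv.2]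
    · rw [List.toFinset_cons, Finset.insert_union, Finset.union_insert]
    · intro r hr
      rw [Finset.mem_insert, not_or]
      exact ⟨fun h => hv.1 (h ▸ hr), hS r (by simp [hr])⟩

/-! ### Dropping balls on an interval -/

/-- Gambler's ruin: `[p - c]` is harmonic, vanishes at the left exit `c` and equals `[L + 1]` at the
right exit, so the ball exits right with probability `[i] / [L + 1]`. -/
lemma supportProb_interval (q : ℝ≥0) (T : Finset ℤ) (w : List ℤ) (c : ℤ) (L i : ℕ)
    (hi : 0 < i) (hiL : i ≤ L) :
    qInt q (L + 1) * supportProb q T (Finset.Icc (c + 1) (c + L), (c + i) :: w) =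
      (qInt q (L + 1) - qInt q i) * supportProb q T (Finset.Icc c (c + L), w) +
        qInt q i * supportProb q T (Finset.Icc (c + 1) (c + L + 1), w) := by
  set S := Finset.Icc (c + 1) (c + L) with hS
  set α := supportProb q T (Finset.Icc c (c + L), w)
  set β := supportProb q T (Finset.Icc (c + 1) (c + L + 1), w)
  have hf : HarmonicOn q (fun p => qInt q (L + 1) * supportProb q T (S, p :: w)) S := by
    intro p hp
    linear_combination qInt q (L + 1) * supportProb_move q T hp w
  have hg : HarmonicOn q (fun p => (qInt q (L + 1) - qInt q (p - c).toNat) * α +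
      qInt q (p - c).toNat * β) S := by
    intro p hp
    rw [hS, Finset.mem_Icc] at hp
    obtain ⟨k, rfl⟩ : ∃ k : ℕ, p = c + (k + 1) := ⟨(p - c - 1).toNat, by omega⟩
    have e1 : (c + ((k : ℤ) + 1) - c).toNat = k + 1 := by omega
    have e2 : (c + ((k : ℤ) + 1) - 1 - c).toNat = k := by omega
    have e3 : (c + ((k : ℤ) + 1) + 1 - c).toNat = k + 2 := by omega
    simp only [e1, e2, e3]
    linear_combination (β - α) * qInt_balance q k
  have := hf.eqOn hg ?_ (c + i) (by rw [hS, Finset.mem_Icc]; omega)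
  · simpa using this
  · intro p hp hn
    have hins := supportProb_rest q T hp w
    simp only [hS, Finset.mem_Icc] at hp hn
    obtain rfl | rfl : p = c ∨ p = c + L + 1 := by omega
    · have : insert p S = Finset.Icc p (p + L) := by ext; simp [hS]; omega
      simp only [hins, this, sub_self, Int.toNat_zero, qInt_zero]
      ring
    · have h1 : insert (c + L + 1) S = Finset.Icc (c + 1) (c + L + 1) := by ext; simp [hS]; omega
      have h2 : (c + (L : ℤ) + 1 - c).toNat = L + 1 := by omega
      simp only [hins, h1, h2]
      ring

/-- The probability that, on an interval with `y + i - 1` sites to the left and `x + j - 1` sites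
to the right of the site where a ball is dropped, the ball exits to the left. -/
def leftProb (q : ℝ≥0) (x y i j : ℕ) : ℝ :=
  (q : ℝ) ^ (y + i) * qInt q (x + j) / qInt q (x + y + i + j)

/-- The probability that, on an interval with `y + i - 1` sites to the left and `x + j - 1` sites
to the right of the site where a ball is dropped, the ball exits to the right. -/
def rightProb (q : ℝ≥0) (x y i j : ℕ) : ℝ :=
  qInt q (y + i) / qInt q (x + y + i + j)

/-- The interval with `y + i - 1` sites to the left and `x + j - 1` sites to the right of `M`. -/
def siteInterval (M : ℤ) (x y i j : ℕ) : Finset ℤ :=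
  Finset.Icc (M - y + 1 - i) (M + x - 1 + j)

lemma supportProb_siteInterval (q : ℝ≥0) (T : Finset ℤ) (w : List ℤ) (M : ℤ) (x y i j : ℕ)
    (hx : 0 < x) (hy : 0 < y) :
    supportProb q T (siteInterval M x y i j, M :: w) =
      leftProb q x y i j * supportProb q T (siteInterval M x y (i + 1) j, w) +
        rightProb q x y i j * supportProb q T (siteInterval M x y i (j + 1), w) := by
  obtain ⟨L, hL⟩ : ∃ L, x + y + i + j = L + 1 := ⟨x + y + i + j - 1, by omega⟩
  have key := supportProb_interval q T w (M - y - i) L (y + i) (by omega) (by omega)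
  have hL' : (x : ℤ) + y + i + j = L + 1 := by exact_mod_cast hL
  have e0 : M - y - i + ((y + i : ℕ) : ℤ) = M := by push_cast; ring
  have e1 : Finset.Icc (M - y - i + 1) (M - y - i + (L : ℤ)) = siteInterval M x y i j := by
    rw [siteInterval]; congr 1 <;> linarith
  have e2 : Finset.Icc (M - y - i) (M - y - i + (L : ℤ)) = siteInterval M x y (i + 1) j := by
    rw [siteInterval]; push_cast; congr 1 <;> linarith
  have e3 : Finset.Icc (M - y - i + 1) (M - y - i + (L : ℤ) + 1) =
      siteInterval M x y i (j + 1) := by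
    rw [siteInterval]; push_cast; congr 1 <;> linarith
  have e4 : qInt q (L + 1) - qInt q (y + i) = (q : ℝ) ^ (y + i) * qInt q (x + j) := by
    rw [← hL, show x + y + i + j = (y + i) + (x + j) by ring, qInt_add]; ring
  rw [e0, e1, e2, e3, e4] at key
  have hpos := (qInt_succ_pos q L).ne'
  rw [leftProb, rightProb, hL]
  field_simp
  linear_combination key

/-- The total weight of the lattice paths with `k` steps from `(i, j)` to `(r, s)`: the probability
that `k` balls dropped at the same site extend the interval of `(i, j)` to that of `(r, s)`. -/
def pathWeight (q : ℝ≥0) (x y r s : ℕ) : ℕ → ℕ → ℕ → ℝ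
  | 0, i, j => if i = r ∧ j = s then 1 else 0
  | k + 1, i, j => leftProb q x y i j * pathWeight q x y r s k (i + 1) j +
      rightProb q x y i j * pathWeight q x y r s k i (j + 1)

lemma supportProb_replicate (q : ℝ≥0) (M : ℤ) (x y r s : ℕ) (hx : 0 < x) (hy : 0 < y)
    (k i j : ℕ) :
    supportProb q (siteInterval M x y r s) (siteInterval M x y i j, List.replicate k M) =
      pathWeight q x y r s k i j := by
  induction k generalizing i j with
  | zero =>
    rw [List.replicate_zero, supportProb_nil, pathWeight]
    refine if_congr ⟨fun h => ?_, fun h => by rw [h.1, h.2]⟩ rfl rfl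
    -- Since `x, y > 0` the intervals are nonempty, so testing their endpoints recovers `(i, j)`.
    have h1 := Finset.ext_iff.1 h (M - y + 1 - i)
    have h2 := Finset.ext_iff.1 h (M - y + 1 - r)
    have h3 := Finset.ext_iff.1 h (M + x - 1 + j)
    have h4 := Finset.ext_iff.1 h (M + x - 1 + s)
    simp only [siteInterval, Finset.mem_Icc] at h1 h2 h3 h4
    omega
  | succ k ih =>
    rw [List.replicate_succ, supportProb_siteInterval q _ _ M x y i j hx hy, ih, ih, pathWeight]

/-- `pathWeight` peels off the first step of a path, whereas the recursion needs the last one; the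
induction passes from one to the other. -/
lemma pathWeight_last_both (q : ℝ≥0) (x y r s k i j : ℕ) :
    pathWeight q x y (r + 1) (s + 1) (k + 1) i j =
      leftProb q x y r (s + 1) * pathWeight q x y r (s + 1) k i j +
        rightProb q x y (r + 1) s * pathWeight q x y (r + 1) s k i j := by
  induction k generalizing i j with
  | zero =>
    simp only [pathWeight, add_left_inj]
    congr 1
    · by_cases h : i = r ∧ j = s + 1 <;> simp [h]
    · by_cases h : i = r + 1 ∧ j = s <;> simp [h]
  | succ k ih =>
    rw [pathWeight, ih, ih]
    simp only [pathWeight]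
    ring

lemma pathWeight_last_left (q : ℝ≥0) (x y r k i j : ℕ) :
    pathWeight q x y (r + 1) 0 (k + 1) i j =
      leftProb q x y r 0 * pathWeight q x y r 0 k i j := by
  induction k generalizing i j with
  | zero =>
    simp only [pathWeight, add_left_inj]
    by_cases h : i = r ∧ j = 0 <;> simp [h]
  | succ k ih =>
    rw [pathWeight, ih, ih]
    simp only [pathWeight]
    ring

lemma pathWeight_last_right (q : ℝ≥0) (x y s k i j : ℕ) :
    pathWeight q x y 0 (s + 1) (k + 1) i j =
      rightProb q x y 0 s * pathWeight q x y 0 s k i j := by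
  induction k generalizing i j with
  | zero =>
    simp only [pathWeight, add_left_inj]
    by_cases h : i = 0 ∧ j = s <;> simp [h]
  | succ k ih =>
    rw [pathWeight, ih, ih]
    simp only [pathWeight]
    ring

/-! ### The multiset of sites -/

/-- The multiset in which `k + i` occurs as often as the `i`-th entry of the list says. -/
def sitesFrom : ℤ → List ℕ → Multiset ℤ
  | _, [] => 0
  | k, a :: l => Multiset.replicate a (k + 1) + sitesFrom (k + 1) l

lemma sum_replicate_eq_sitesFrom (l : List ℕ) (k : ℤ) :
    ∑ i : Fin l.length, Multiset.replicate (l.get i) ((i : ℤ) + (k + 1)) = sitesFrom k l := by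
  induction l generalizing k with
  | nil => rfl
  | cons a l ih =>
    refine (Fin.sum_univ_succ (n := l.length) _).trans ?_
    rw [sitesFrom, ← ih]
    congr 1
    · simp
    · refine Finset.sum_congr rfl fun i _ => ?_
      simp only [List.get_eq_getElem, Fin.val_succ, List.getElem_cons_succ]
      congr 1
      push_cast
      ring

lemma Configuration.mset_eq_sitesFrom (c : Configuration) : c.mset = sitesFrom 0 c.tuple := by
  rw [← sum_replicate_eq_sitesFrom, Configuration.mset, zero_add]

lemma sitesFrom_append (l₁ l₂ : List ℕ) (k : ℤ) :
    sitesFrom k (l₁ ++ l₂) = sitesFrom k l₁ + sitesFrom (k + l₁.length) l₂ := by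
  induction l₁ generalizing k with
  | nil => simp [sitesFrom]
  | cons a l ih =>
    rw [List.cons_append, sitesFrom, sitesFrom, ih, List.length_cons, ← add_assoc,
      show k + ((l.length + 1 : ℕ) : ℤ) = k + 1 + l.length by push_cast; ring]

lemma sitesFrom_replicate_zero (n : ℕ) (k : ℤ) : sitesFrom k (List.replicate n 0) = 0 := by
  induction n generalizing k with
  | zero => rfl
  | succ n ih => rw [List.replicate_succ, sitesFrom, ih]; simp

lemma count_Icc (a b p : ℤ) :
    Multiset.count p (Finset.Icc a b).val = if a ≤ p ∧ p ≤ b then 1 else 0 := by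
  rw [Multiset.count_eq_of_nodup (Finset.Icc a b).nodup]
  simp only [Finset.mem_val, Finset.mem_Icc]

lemma sitesFrom_replicate_one (n : ℕ) (k : ℤ) :
    sitesFrom k (List.replicate n 1) = (Finset.Icc (k + 1) (k + n)).val := by
  induction n generalizing k with
  | zero => simp [sitesFrom]
  | succ n ih =>
    rw [List.replicate_succ, sitesFrom, ih]
    ext p
    rw [Multiset.count_add, Multiset.count_replicate, count_Icc, count_Icc]
    push_cast
    split_ifs <;> omega

lemma mset_csConfiguration (r s x y : ℕ) (hx : 0 < x) (hy : 0 < y) :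
    (csConfiguration r s x y).mset =
      (((siteInterval (r + y) x y 0 0).toList ++ List.replicate (r + s) ((r : ℤ) + y) :
        List ℤ) : Multiset ℤ) := by
  rw [Configuration.mset_eq_sitesFrom, csConfiguration, ← Multiset.coe_add, Finset.coe_toList,
    Multiset.coe_replicate]
  simp only [sitesFrom_append, sitesFrom_replicate_zero, sitesFrom_replicate_one, sitesFrom,
    List.length_append, List.length_replicate, List.length_cons, List.length_nil, siteInterval]
  ext p
  simp only [Multiset.count_add, Multiset.count_replicate, count_Icc, Multiset.count_zero]
  push_cast [Nat.cast_sub (show 1 ≤ x from hx), Nat.cast_sub (show 1 ≤ y from hy)]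
  split_ifs <;> omega

/-! ### The recursion -/

lemma size_csConfiguration (r s x y : ℕ) (hx : 0 < x) (hy : 0 < y) :
    (csConfiguration r s x y).size = (x + y - 1) + (r + s) := by
  simp [csConfiguration, Configuration.size]
  omega

lemma genEulerian_eq_pathWeight (order : Configuration → List ℤ)
    (order_content : ∀ c : Configuration, (order c : Multiset ℤ) = c.mset)
    (q : ℝ≥0) (r s x y : ℕ) (hx : 0 < x) (hy : 0 < y) :
    genEulerian order q r s x y =
      qFactorial q ((x + y - 1) + (r + s)) * pathWeight q x y r s (r + s) 0 0 /
        qFactorial q (x + y - 1) := by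
  have hperm := Multiset.coe_eq_coe.1
    ((order_content _).trans (mset_csConfiguration r s x y hx hy))
  have hT : Finset.Icc 1 (((x + y - 1) + (r + s) : ℕ) : ℤ) = siteInterval (r + y) x y r s := by
    rw [siteInterval]
    congr 1
    · ring
    · omega
  have hprob : finalSupportProb q (order (csConfiguration r s x y))
      (siteInterval (r + y) x y r s) = pathWeight q x y r s (r + s) 0 0 := by
    rw [← supportProb_replicate q (r + y) x y r s hx hy]
    refine (supportProb_perm q _ hperm ∅).trans ?_
    rw [supportProb_append_of_nodup q _ _ _ (Finset.nodup_toList _) _ (by simp)]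
    simp
  rw [genEulerian, remixedEulerian, size_csConfiguration r s x y hx hy, hT, hprob]

end RemixedEulerian

end

theorem mainTheorem5
    (order : RemixedEulerian.Configuration → List ℤ)
    (order_content : ∀ c : RemixedEulerian.Configuration, (order c : Multiset ℤ) = c.mset)
    (q : NNReal) (x y : ℕ) (hx : 0 < x) (hy : 0 < y) :
    (∀ r s : ℕ, 0 < r → 0 < s →
      RemixedEulerian.genEulerian order q r s x y =
        (q : ℝ) ^ (r + y - 1) * RemixedEulerian.qInt q (s + x) *
            RemixedEulerian.genEulerian order q (r - 1) s x y +
          RemixedEulerian.qInt q (r + y) *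
            RemixedEulerian.genEulerian order q r (s - 1) x y) ∧
    (∀ r : ℕ, 0 < r →
      RemixedEulerian.genEulerian order q r 0 x y =
        (q : ℝ) ^ (r + y - 1) * RemixedEulerian.qInt q x *
          RemixedEulerian.genEulerian order q (r - 1) 0 x y) ∧
    (∀ s : ℕ, 0 < s →
      RemixedEulerian.genEulerian order q 0 s x y =
        RemixedEulerian.qInt q y * RemixedEulerian.genEulerian order q 0 (s - 1) x y) ∧
    RemixedEulerian.genEulerian order q 0 0 x y = 1 := by
  open RemixedEulerian in
  have hA := fun r s => genEulerian_eq_pathWeight order order_content q r s x y hx hy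
  have hF := fun n => (qFactorial_pos q n).ne'
  have hQ := fun n => (qInt_succ_pos q n).ne'
  obtain ⟨m, hm⟩ : ∃ m, x + y = m + 1 := ⟨x + y - 1, by omega⟩
  have hm1 : x + y - 1 = m := by omega
  rw [hm1] at hA
  refine ⟨?_, ?_, ?_, ?_⟩
  · rintro (_ | r) (_ | s) hr hs
    · omega
    · omega
    · omega
    -- Both possible last steps have the same denominator, the factor that `qFactorial_succ` splits
    -- off.
    have e1 : m + (r + 1 + (s + 1)) = m + (r + s + 1) + 1 := by ring
    have e2 : x + y + r + (s + 1) = m + (r + s + 1) + 1 := by omega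
    have e3 : x + y + (r + 1) + s = m + (r + s + 1) + 1 := by omega
    have e4 : r + (s + 1) = r + s + 1 := by ring
    have e5 : r + 1 + s = r + s + 1 := by ring
    simp only [Nat.add_sub_cancel]
    rw [hA, hA, hA, e1, qFactorial_succ, e4, e5, show r + 1 + (s + 1) = (r + s + 1) + 1 by ring,
      pathWeight_last_both, leftProb, rightProb, e2, e3, show r + 1 + y - 1 = y + r by omega,
      add_comm (s + 1) x, add_comm (r + 1) y]
    have := hF m
    have := hQ (m + (r + s + 1))
    field_simp
  · rintro (_ | r) hr
    · omega
    simp only [Nat.add_sub_cancel]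
    rw [hA, hA, add_zero, add_zero, ← add_assoc, qFactorial_succ, pathWeight_last_left, leftProb,
      show x + y + r + 0 = m + r + 1 by omega, show r + 1 + y - 1 = y + r by omega, add_zero]
    have := hF m
    have := hQ (m + r)
    field_simp
  · rintro (_ | s) hs
    · omega
    simp only [Nat.add_sub_cancel]
    rw [hA, hA, zero_add, zero_add, ← add_assoc, qFactorial_succ, pathWeight_last_right, rightProb,
      show x + y + 0 + s = m + s + 1 by omega, add_zero]
    have := hF m
    have := hQ (m + s)
    field_simp
  · rw [hA]
    simp [pathWeight, hF m]
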